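/- For integers $n\ge 0$ and $r\ge 1$ let $h_n^{(r)}=\sum_{k=1}^{n}\frac{1}{(k-1/2)^r}$ (so $h_0^{(r)}=0$), and for integers $p\ge 1$, $q\ge 2$ put $$T_{p,q}=\sum_{n=1}^{\infty}\frac{h_{n-1}^{(p)}}{(n-1/2)^q},\qquad \check S_{p,q}=\sum_{n=1}^{\infty}\frac{h_n^{(p)}}{n^q};$$ these series converge. For integers $s\ge 2$ let $\zeta(s)=\sum_{n\ge 1}n^{-s}$ and $\tilde t(s)=\sum_{n\ge1}(n-1/2)^{-s}$, and set by convention $\zeta(1):=-2\ln 2$ and $\tilde t(1):=0$. For a family $\Omega_{p,q}$ of real numbers and an integer $m\ge 1$ write $$\lambda_m(\Omega_{p,q})=\sum_{\substack{i+j=m-1\\ i,j\ge 0}}\binom{p+i-1}{i}\binom{q+j-1}{j}\,\Omega_{p+i,q+j}.$$ **Theorem.** For all integers $m,p\ge 1$ and $q\ge 2$, the number $$(-1)^{m-1}\lambda_p(T_{m,q})+(-1)^{p-1}\lambda_m(\check S_{p,q})$$ belongs to $\mathbb{Q}[\ln 2,\text{zeta values}]$, the $\mathbb{Q}$-subalgebra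 of $\mathbb{R}$ generated by $\ln 2$ and the numbers $\zeta(k)$ for integers $k\ge 2$. More precisely, $$(-1)^{m-1}\lambda_p(T_{m,q})+(-1)^{p-1}\lambda_m(\check S_{p,q})=(-1)^m\lambda_p\big((-1)^m\tilde t(m)\tilde t(q)\big)+(-1)^p\lambda_m\big((-1)^p\tilde t(p)\zeta(q)\big)-\lambda_q\big(\zeta(m)\tilde t(p)\big),$$ where on the right-hand side $\lambda_p$, $\lambda_m$, $\lambda_q$ are applied to the families $\Omega_{a,b}=(-1)^a\tilde t(a)\tilde t(b)$ at $(a,b)=(m,q)$, $\Omega_{a,b}=(-1)^a\tilde t(a)\zeta(b)$ at $(a,b)=(p,q)$, and $\Omega_{a,b}=\zeta(a)\tilde t(b)$ at $(a,b)=(m,p)$, respectively. -/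

import Mathlib

namespace EulerSums

noncomputable section

/-- The odd harmonic number `h_n^{(r)} = ∑_{k=1}^n 1 / (k - 1/2)^r`; in particular `h_0^{(r)} = 0`. -/
def oddHarmonic (n r : ℕ) : ℝ :=
  ∑ k ∈ Finset.Icc 1 n, 1 / ((k : ℝ) - 1 / 2) ^ r

/-- The `n`-th term (`n ≥ 1`) of the series `T_{p,q}`. -/
def termT (p q n : ℕ) : ℝ :=
  oddHarmonic (n - 1) p / ((n : ℝ) - 1 / 2) ^ q

/-- The `n`-th term (`n ≥ 1`) of the series `Š_{p,q}`. -/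
def termS (p q n : ℕ) : ℝ :=
  oddHarmonic n p / (n : ℝ) ^ q

/-- `T_{p,q} = ∑_{n ≥ 1} h_{n-1}^{(p)} / (n - 1/2)^q`; the summation index is shifted by one. -/
def sumT (p q : ℕ) : ℝ :=
  ∑' n : ℕ, termT p q (n + 1)

/-- `Š_{p,q} = ∑_{n ≥ 1} h_n^{(p)} / n^q`; the summation index is shifted by one. -/
def sumS (p q : ℕ) : ℝ :=
  ∑' n : ℕ, termS p q (n + 1)

/-- `ζ(s) = ∑_{n ≥ 1} 1 / n^s` for integers `s ≥ 2`, as a real number. -/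
def zetaValue (s : ℕ) : ℝ :=
  ∑' n : ℕ, 1 / ((n + 1 : ℕ) : ℝ) ^ s

/-- For `s ≥ 2` this is the value at `s` of the Riemann zeta function. -/
theorem zetaValue_eq_riemannZeta {s : ℕ} (hs : 2 ≤ s) :
    (zetaValue s : ℂ) = riemannZeta s := by
  have h := zeta_eq_tsum_one_div_nat_add_one_cpow (s := (s : ℂ))
    (by rw [Complex.natCast_re]; exact_mod_cast hs)
  rw [h, zetaValue, Complex.ofReal_tsum]
  refine tsum_congr fun n => ?_
  rw [Complex.cpow_natCast]
  push_cast
  rfl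

/-- `t̃(s) = ∑_{n ≥ 1} 1 / (n - 1/2)^s` for integers `s ≥ 2`. -/
def tTildeValue (s : ℕ) : ℝ :=
  ∑' n : ℕ, 1 / (((n + 1 : ℕ) : ℝ) - 1 / 2) ^ s

/-- `ζ(s)` with the convention `ζ(1) := -2 ln 2`. -/
def zetaConv (s : ℕ) : ℝ :=
  if s = 1 then -2 * Real.log 2 else zetaValue s

/-- `t̃(s)` with the convention `t̃(1) := 0`. -/
def tTildeConv (s : ℕ) : ℝ :=
  if s = 1 then 0 else tTildeValue s

/-- The operator `λ_m`, for `m ≥ 1`, on families `Ω` with two positive integer indices: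
`λ_m(Ω_{p,q}) = ∑_{i+j=m-1} C(p+i-1, i) C(q+j-1, j) Ω_{p+i,q+j}`. -/
def lam (m : ℕ) (Ω : ℕ → ℕ → ℝ) (p q : ℕ) : ℝ :=
  ∑ ij ∈ Finset.HasAntidiagonal.antidiagonal (m - 1),
    ((p + ij.1 - 1).choose ij.1 : ℝ) * ((q + ij.2 - 1).choose ij.2 : ℝ) *
      Ω (p + ij.1) (q + ij.2)

/-- The ring `ℚ[ln 2, zeta values]`: the `ℚ`-subalgebra of `ℝ` generated by `ln 2` and by the
numbers `ζ(k)` for integers `k ≥ 2`. -/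
def logZetaAlgebra : Subalgebra ℚ ℝ :=
  Algebra.adjoin ℚ ({Real.log 2} ∪ {x : ℝ | ∃ k : ℕ, 2 ≤ k ∧ x = zetaValue k})

end

end EulerSums

/-!
The relation is the vanishing of the sum of all residues of `F(s) G(s) / s ^ q`, where
`F(s) = ∑ (s + b - 1/2) ^ (-p)` and `G(s) = ∑ (s + a) ^ (-m)`, both over the positive integers. The
pole at `0` contributes `λ_q(ζ(m) t̃(p))`. At `-a` the value of `∑ (b - 1/2 - a) ^ (-r)` splits by
sign into `t̃(r) + (-1) ^ r h_a^{(r)}`, which gives `Š` and the products `t̃ ζ`; in the same way the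
poles at `1/2 - b` give `T` and the products `t̃ t̃`.

No complex analysis is needed, since everything can be done termwise. For a single pair `(a, b)` the
residues of `1 / (s ^ q (s + y) ^ m (s + x) ^ p)` add up to zero by the partial fraction
recursion (`residue_sum_three`, `lam_three_term`), where the Laurent coefficients are coefficients
of powers of the power series `1 / (X + c)`. Summing over `a, b ≤ N` gives an identity between finite
sums (`lam_truncated`). Those with exponent `1` diverge like `∑ 1 / (b - 1/2)` over `b ≤ N`.
Subtracting this sum from each of them does not affect the identity when `q ≥ 2`
(`lam_regularized`), and is the origin of the conventions `t̃(1) = 0` and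
`ζ(1) = ∑ (1 / a - 1 / (a - 1/2)) = -2 ln 2`. The bound `h_n^{(1)} ≤ 4 √n` allows the
passage to the limit by dominated convergence (`tendsto_sum_mul_oddSum`).

The right-hand side lies in `ℚ[ln 2, zeta values]` because `t̃(k) = (2 ^ k - 1) ζ(k)` for `k ≥ 2`.
-/

namespace EulerSums

open Finset PowerSeries Filter Topology

/-! ### Partial fractions -/

/-- The expansion of `1 / (X + c)` as a power series in `X`, for `c ≠ 0`. -/
noncomputable def invXAdd (c : ℝ) : PowerSeries ℝ :=
  PowerSeries.mk fun k => (-1) ^ k * c⁻¹ ^ (k + 1)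

lemma X_add_C_mul_invXAdd {c : ℝ} (hc : c ≠ 0) :
    ((X : PowerSeries ℝ) + C c) * invXAdd c = 1 := by
  ext k
  rw [add_mul, map_add, coeff_C_mul]
  cases k with
  | zero => simp [invXAdd, hc]
  | succ k =>
    rw [coeff_succ_X_mul]
    simp only [invXAdd, coeff_mk, coeff_one, Nat.succ_ne_zero, if_false]
    linear_combination (-((-1 : ℝ) ^ k * c⁻¹ ^ (k + 1))) * mul_inv_cancel₀ hc

lemma coeff_invXAdd_pow {c : ℝ} (hc : c ≠ 0) (n k : ℕ) :
    coeff k (invXAdd c ^ n) = (-1) ^ k * ((n + k - 1).choose k : ℝ) * c⁻¹ ^ (n + k) := by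
  induction n generalizing k with
  | zero =>
    cases k with
    | zero => simp
    | succ k => simp [coeff_one]
  | succ n ihn =>
    have h : ((X : PowerSeries ℝ) + C c) * invXAdd c ^ (n + 1) = invXAdd c ^ n := by
      rw [pow_succ', ← mul_assoc, X_add_C_mul_invXAdd hc, one_mul]
    induction k with
    | zero => simp [invXAdd]
    | succ k ihk =>
      have h1 := congrArg (coeff (k + 1)) h
      rw [add_mul, map_add, coeff_C_mul, coeff_succ_X_mul, ihk, ihn] at h1
      have e1 : n + 1 + k - 1 = n + k := by omega
      have e2 : n + (k + 1) - 1 = n + k := by omega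
      have e3 : n + 1 + (k + 1) - 1 = n + k + 1 := by omega
      rw [e1, e2] at h1
      rw [e3, Nat.choose_succ_succ]
      have h2 : coeff (k + 1) (invXAdd c ^ (n + 1))
          = c⁻¹ * (c * coeff (k + 1) (invXAdd c ^ (n + 1))) := by
        field_simp
      rw [h2, eq_sub_of_add_eq' h1]
      push_cast
      ring

lemma lam_congr {m p q : ℕ} {Ω Ω' : ℕ → ℕ → ℝ}
    (h : ∀ i j, i + j = m - 1 → Ω (p + i) (q + j) = Ω' (p + i) (q + j)) :
    lam m Ω p q = lam m Ω' p q :=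
  Finset.sum_congr rfl fun ij hij => by rw [h _ _ (mem_antidiagonal.mp hij)]

lemma lam_add (m p q : ℕ) (Ω Ω' : ℕ → ℕ → ℝ) :
    lam m (fun a b => Ω a b + Ω' a b) p q = lam m Ω p q + lam m Ω' p q := by
  simp only [lam, mul_add, Finset.sum_add_distrib]

lemma lam_sub (m p q : ℕ) (Ω Ω' : ℕ → ℕ → ℝ) :
    lam m (fun a b => Ω a b - Ω' a b) p q = lam m Ω p q - lam m Ω' p q := by
  simp only [lam, mul_sub, Finset.sum_sub_distrib]

lemma lam_const_mul (m p q : ℕ) (c : ℝ) (Ω : ℕ → ℕ → ℝ) :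
    lam m (fun a b => c * Ω a b) p q = c * lam m Ω p q := by
  simp only [lam, Finset.mul_sum]
  exact Finset.sum_congr rfl fun _ _ => by ring

lemma lam_finset_sum {ι : Type*} (s : Finset ι) (m p q : ℕ) (Ω : ι → ℕ → ℕ → ℝ) :
    lam m (fun a b => ∑ k ∈ s, Ω k a b) p q = ∑ k ∈ s, lam m (Ω k) p q := by
  simp only [lam, Finset.mul_sum]
  exact Finset.sum_comm

/-- Up to sign, `λ` computes the Taylor coefficients at `0` of `1 / ((s + x) ^ p * (s + y) ^ q)`. -/
lemma coeff_invXAdd_pow_mul {x y : ℝ} (hx : x ≠ 0) (hy : y ≠ 0) (k p q : ℕ) :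
    coeff k (invXAdd x ^ p * invXAdd y ^ q)
      = (-1) ^ k * lam (k + 1) (fun a b => x⁻¹ ^ a * y⁻¹ ^ b) p q := by
  rw [coeff_mul, lam, Finset.mul_sum]
  refine Finset.sum_congr rfl fun ij hij => ?_
  rw [coeff_invXAdd_pow hx, coeff_invXAdd_pow hy, ← show ij.1 + ij.2 = k from mem_antidiagonal.mp hij,
      pow_add]
  ring

/-- The coefficient of `X ^ (n - 1)`, read as `0` for `n = 0`: the residue at `0` of
`f / X ^ n`. -/
noncomputable def resCoeff (n : ℕ) (f : PowerSeries ℝ) : ℝ :=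
  coeff n (X * f)

lemma resCoeff_zero (f : PowerSeries ℝ) : resCoeff 0 f = 0 := by simp [resCoeff]

lemma resCoeff_succ (n : ℕ) (f : PowerSeries ℝ) : resCoeff (n + 1) f = coeff n f := by
  simp [resCoeff, coeff_succ_X_mul]

/-- Two poles: the residues of `1 / (s ^ (q + 1) * (s + x) ^ n)` at `0` and at `-x` add up to `0`. -/
lemma residue_sum_two {x : ℝ} (hx : x ≠ 0) (q n : ℕ) (hn : n ≠ 0) :
    resCoeff (q + 1) (invXAdd x ^ n) + resCoeff n (invXAdd (-x) ^ (q + 1)) = 0 := by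
  cases n with
  | zero => exact absurd rfl hn
  | succ n =>
    rw [resCoeff_succ, resCoeff_succ, coeff_invXAdd_pow hx, coeff_invXAdd_pow (neg_ne_zero.mpr hx)]
    have e1 : n + 1 + q - 1 = n + q := by omega
    have e2 : q + 1 + n - 1 = n + q := by omega
    rw [e1, e2, ← Nat.choose_symm_add, inv_neg, neg_pow x⁻¹, add_comm (q + 1) n,
      show n + 1 + q = n + (q + 1) by ring, pow_add (-1 : ℝ) n, pow_succ (-1 : ℝ) q]
    have h : ((-1 : ℝ) ^ n) * (-1) ^ n = 1 := by rw [← mul_pow]; simp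
    linear_combination (-((-1 : ℝ) ^ q) * ((n + q).choose n : ℝ) * x⁻¹ ^ (n + (q + 1))) * h

/-- Three poles: the residues of `1 / (s ^ (q + 1) * (s + y) ^ m * (s + x) ^ p)` at `0`, `-y` and
`-x` add up to `0`. -/
lemma residue_sum_three {x y : ℝ} (hx : x ≠ 0) (hy : y ≠ 0) (hxy : x ≠ y) (q m p : ℕ)
    (hmp : m + p ≠ 0) :
    resCoeff (q + 1) (invXAdd y ^ m * invXAdd x ^ p)
      + resCoeff m (invXAdd (x - y) ^ p * invXAdd (-y) ^ (q + 1))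
      + resCoeff p (invXAdd (y - x) ^ m * invXAdd (-x) ^ (q + 1)) = 0 := by
  have hd : x - y ≠ 0 := sub_ne_zero.mpr hxy
  have hd' : y - x ≠ 0 := sub_ne_zero.mpr hxy.symm
  induction m generalizing p with
  | zero =>
    have := residue_sum_two hx q p (by omega)
    simpa [resCoeff_zero] using this
  | succ m ihm =>
    induction p with
    | zero =>
      have := residue_sum_two hy q (m + 1) m.succ_ne_zero
      simpa [resCoeff_zero] using this
    | succ p ihp =>
      -- `(y - x) / ((s + y) (s + x)) = 1 / (s + x) - 1 / (s + y)`, expanded at each pole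
      have h1 := ihm (p + 1) (by omega)
      have h2 := ihp (by omega)
      have hX := X_add_C_mul_invXAdd hx
      have hY := X_add_C_mul_invXAdd hy
      have hD := X_add_C_mul_invXAdd hd
      have hD' := X_add_C_mul_invXAdd hd'
      have k0 : C (y - x) * (invXAdd y ^ (m + 1) * invXAdd x ^ (p + 1))
          = invXAdd y ^ m * invXAdd x ^ (p + 1) - invXAdd y ^ (m + 1) * invXAdd x ^ p := by
        rw [map_sub]
        linear_combination invXAdd y ^ m * invXAdd x ^ (p + 1) * hY
          - invXAdd y ^ (m + 1) * invXAdd x ^ p * hX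
      have k1 : C (y - x) * (invXAdd (x - y) ^ (p + 1) * invXAdd (-y) ^ (q + 1))
          = X * (invXAdd (x - y) ^ (p + 1) * invXAdd (-y) ^ (q + 1))
            - invXAdd (x - y) ^ p * invXAdd (-y) ^ (q + 1) := by
        rw [map_sub] at hD ⊢
        linear_combination (-(invXAdd (x - y) ^ p * invXAdd (-y) ^ (q + 1))) * hD
      have k2 : C (y - x) * (invXAdd (y - x) ^ (m + 1) * invXAdd (-x) ^ (q + 1))
          = invXAdd (y - x) ^ m * invXAdd (-x) ^ (q + 1)
            - X * (invXAdd (y - x) ^ (m + 1) * invXAdd (-x) ^ (q + 1)) := by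
        linear_combination (invXAdd (y - x) ^ m * invXAdd (-x) ^ (q + 1)) * hD'
      have k0' := congrArg (coeff q) k0
      have k1' := congrArg (coeff m) k1
      have k2' := congrArg (coeff p) k2
      rw [coeff_C_mul, map_sub] at k0' k1' k2'
      simp only [resCoeff_succ] at h1 h2 ⊢
      refine (mul_eq_zero.mp ?_).resolve_left hd'
      rw [resCoeff] at h1 h2
      linear_combination k0' + k1' + k2' + h1 - h2

/-- The three-term relation between the `λ` operators on families of products of powers. -/
lemma lam_three_term {x y : ℝ} (hx : x ≠ 0) (hy : y ≠ 0) (hxy : x ≠ y) (m p q : ℕ) :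
    (-1) ^ q * lam (q + 1) (fun a b => y⁻¹ ^ a * x⁻¹ ^ b) (m + 1) (p + 1)
      + (-1) ^ m * lam (m + 1) (fun a b => (x - y)⁻¹ ^ a * (-y)⁻¹ ^ b) (p + 1) (q + 1)
      + (-1) ^ p * lam (p + 1) (fun a b => (y - x)⁻¹ ^ a * (-x)⁻¹ ^ b) (m + 1) (q + 1) = 0 := by
  have h := residue_sum_three hx hy hxy q (m + 1) (p + 1) (by omega)
  simp only [resCoeff_succ] at h
  rwa [coeff_invXAdd_pow_mul hy hx, coeff_invXAdd_pow_mul (sub_ne_zero.mpr hxy) (neg_ne_zero.mpr hy),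
    coeff_invXAdd_pow_mul (sub_ne_zero.mpr hxy.symm) (neg_ne_zero.mpr hx)] at h

/-! ### The relation between truncated sums -/

/-- The truncated zeta value `∑ 1 / a ^ r` over `1 ≤ a ≤ N`. -/
noncomputable def zetaSum (N r : ℕ) : ℝ := ∑ a ∈ range N, ((a : ℝ) + 1)⁻¹ ^ r

/-- The odd harmonic number `h_N^{(r)}`, indexed from `0`. -/
noncomputable def oddSum (N r : ℕ) : ℝ := ∑ b ∈ range N, ((b : ℝ) + 1 / 2)⁻¹ ^ r

/-- The truncation to `a ≤ N` of `∑ a ^ (-s) * ∑ (b - 1/2 - a) ^ (-r)`, where the inner sum, over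
`1 ≤ b ≤ N`, is split according to the sign of `b - 1/2 - a`. -/
noncomputable def truncS (N r s : ℕ) : ℝ :=
  ∑ a ∈ range N, ((a : ℝ) + 1)⁻¹ ^ s * (oddSum (N - (a + 1)) r + (-1) ^ r * oddSum (a + 1) r)

/-- The analogue of `truncS` with the roles of integers and half-integers exchanged. -/
noncomputable def truncT (N r s : ℕ) : ℝ :=
  ∑ b ∈ range N, ((b : ℝ) + 1 / 2)⁻¹ ^ s * (oddSum (N - b) r + (-1) ^ r * oddSum b r)

/-- A sum over a window of consecutive half-integers around `0` splits by sign. -/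
lemma sum_half_int_window {c N : ℕ} (h : c ≤ N) (r : ℕ) :
    ∑ k ∈ range N, ((k : ℝ) + 1 / 2 - c)⁻¹ ^ r = oddSum (N - c) r + (-1) ^ r * oddSum c r := by
  obtain ⟨d, rfl⟩ := Nat.exists_eq_add_of_le h
  rw [Finset.sum_range_add, Nat.add_sub_cancel_left, add_comm, oddSum, oddSum,
    ← Finset.sum_range_reflect _ c, Finset.mul_sum]
  congr 1
  · refine Finset.sum_congr rfl fun k _ => ?_
    push_cast
    congr 2
    ring
  · refine Finset.sum_congr rfl fun k hk => ?_
    have hk' : k + 1 ≤ c := mem_range.mp hk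
    rw [Nat.sub_sub, add_comm 1 k, ← mul_pow, neg_one_mul, ← inv_neg, Nat.cast_sub hk']
    push_cast
    congr 2
    ring

/-- The sum of `lam_three_term` over `x = b - 1/2` and `y = a` with `1 ≤ a, b ≤ N`. -/
lemma lam_truncated (N m p q : ℕ) :
    (-1) ^ q * lam (q + 1) (fun a b => zetaSum N a * oddSum N b) (m + 1) (p + 1)
      + (-1) ^ m * lam (m + 1) (fun r s => (-1) ^ s * truncS N r s) (p + 1) (q + 1)
      + (-1) ^ p * lam (p + 1) (fun r s => (-1) ^ s * truncT N r s) (m + 1) (q + 1) = 0 := by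
  have hne (a b : ℕ) : (b : ℝ) + 1 / 2 ≠ (a : ℝ) + 1 := by
    intro h
    have h2 : ((2 * b + 1 : ℕ) : ℝ) = ((2 * a + 2 : ℕ) : ℝ) := by push_cast; linarith
    have := Nat.cast_injective h2
    omega
  have key : ∑ a ∈ range N, ∑ b ∈ range N, _ = (0 : ℝ) := Finset.sum_eq_zero fun a _ =>
    Finset.sum_eq_zero fun b _ => lam_three_term (x := (b : ℝ) + 1 / 2) (y := (a : ℝ) + 1)
      (by positivity) (by positivity) (hne a b) m p q
  simp only [Finset.sum_add_distrib, ← Finset.mul_sum, ← lam_finset_sum] at key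
  convert key using 2
  · congr 2
    · refine lam_congr fun i j _ => ?_
      simp only [zetaSum, oddSum, Finset.sum_mul]
    · refine lam_congr fun i j _ => ?_
      rw [truncS, Finset.mul_sum]
      refine Finset.sum_congr rfl fun a ha => ?_
      rw [← sum_half_int_window (mem_range.mp ha), ← Finset.sum_mul, inv_neg, neg_pow]
      push_cast
      ring
  · refine congrArg₂ _ rfl (lam_congr fun i j _ => ?_)
    rw [Finset.sum_comm, truncT, Finset.mul_sum]
    refine Finset.sum_congr rfl fun b hb => ?_
    rw [← sum_half_int_window (mem_range.mp hb).le, ← Finset.sum_mul, inv_neg, neg_pow]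
    have h : ∑ a ∈ range N, ((a : ℝ) + 1 - (b + 1 / 2))⁻¹ ^ (m + 1 + i)
        = ∑ a ∈ range N, ((a : ℝ) + 1 / 2 - b)⁻¹ ^ (m + 1 + i) :=
      Finset.sum_congr rfl fun a _ => by congr 2; ring
    rw [h]
    ring

/-! ### Removing the divergent part -/

/-- `zetaSum`, made convergent at `r = 1` by subtracting `∑ 1 / (b - 1/2)`. -/
noncomputable def zetaReg (N r : ℕ) : ℝ := zetaSum N r - if r = 1 then oddSum N 1 else 0

/-- `oddSum`, made convergent at `r = 1` by subtracting `∑ 1 / (b - 1/2)`: it then vanishes. -/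
noncomputable def oddReg (N r : ℕ) : ℝ := oddSum N r - if r = 1 then oddSum N 1 else 0

/-- Only the term with first index `1` survives, and it occurs only if `p + 1 = 1`. -/
lemma lam_ite_left (m p q : ℕ) (g : ℕ → ℝ) :
    lam (m + 1) (fun r s => (if r = 1 then 1 else 0) * g s) (p + 1) (q + 1)
      = if p = 0 then ((m + q).choose m : ℝ) * g (m + q + 1) else 0 := by
  rw [lam, Finset.sum_eq_single (0, m)]
  · rcases eq_or_ne p 0 with rfl | hp
    · have e2 : q + 1 + m = m + q + 1 := by omega
      simp [e2]
    · simp [hp]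
  · rintro ⟨i, j⟩ hij h0
    have : i ≠ 0 := by
      rintro rfl
      simp at hij h0
      exact h0 hij
    have h2 : p + 1 + i ≠ 1 := by omega
    simp [h2]
  · simp

lemma lam_ite_right (m p q : ℕ) (g : ℕ → ℝ) :
    lam (m + 1) (fun r s => (if s = 1 then 1 else 0) * g r) (p + 1) (q + 1)
      = if q = 0 then ((m + p).choose m : ℝ) * g (m + p + 1) else 0 := by
  rw [lam, Finset.sum_eq_single (m, 0)]
  · rcases eq_or_ne q 0 with rfl | hp
    · have e2 : p + 1 + m = m + p + 1 := by omega
      simp [e2]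
    · simp [hp]
  · rintro ⟨i, j⟩ hij h0
    have : j ≠ 0 := by
      rintro rfl
      simp at hij h0
      exact h0 hij
    have h2 : q + 1 + j ≠ 1 := by omega
    simp [h2]
  · simp

/-- The relation of `lam_truncated` persists after the regularization: by `Nat.choose_symm_add` the
subtracted terms cancel. As `q + 1 ≥ 2`, the two indices of `zetaReg N a * oddReg N b` are
never both `1`. -/
lemma lam_regularized (N m p q : ℕ) (hq : q ≠ 0) :
    (-1) ^ q * lam (q + 1) (fun a b => zetaReg N a * oddReg N b) (m + 1) (p + 1)
      + (-1) ^ m * lam (m + 1) (fun r s => (-1) ^ s *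
          (truncS N r s - if r = 1 then oddSum N 1 * zetaSum N s else 0)) (p + 1) (q + 1)
      + (-1) ^ p * lam (p + 1) (fun r s => (-1) ^ s *
          (truncT N r s - if r = 1 then oddSum N 1 * oddSum N s else 0)) (m + 1) (q + 1) = 0 := by
  have h := lam_truncated N m p q
  have h1 : lam (q + 1) (fun a b => zetaReg N a * oddReg N b) (m + 1) (p + 1)
      = lam (q + 1) (fun a b => zetaSum N a * oddSum N b
        - (if a = 1 then 1 else 0) * (oddSum N 1 * oddSum N b)
        - (if b = 1 then 1 else 0) * (oddSum N 1 * zetaSum N a)) (m + 1) (p + 1) := by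
    refine lam_congr fun i j hij => ?_
    have : ¬ (m + 1 + i = 1 ∧ p + 1 + j = 1) := by omega
    simp only [zetaReg, oddReg]
    split_ifs <;> first | (exfalso; tauto) | ring
  have h2 (U : ℕ → ℕ → ℝ) (g : ℕ → ℝ) (m p : ℕ) : lam (m + 1) (fun r s => (-1) ^ s *
          (U r s - if r = 1 then oddSum N 1 * g s else 0)) (p + 1) (q + 1)
      = lam (m + 1) (fun r s => (-1) ^ s * U r s
        - (if r = 1 then 1 else 0) * ((-1) ^ s * (oddSum N 1 * g s))) (p + 1) (q + 1) := by
    refine lam_congr fun i j hij => ?_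
    split_ifs <;> ring
  rw [h1, h2, h2]
  simp only [lam_sub]
  rw [lam_ite_left q m p, lam_ite_right q m p (fun r => oddSum N 1 * zetaSum N r),
    lam_ite_left m p q, lam_ite_left p m q]
  have hm : ((-1 : ℝ) ^ m) * (-1) ^ m = 1 := by rw [← mul_pow]; simp
  have hp : ((-1 : ℝ) ^ p) * (-1) ^ p = 1 := by rw [← mul_pow]; simp
  have cm : (q + m).choose q = (m + q).choose m := by rw [add_comm q m, Nat.choose_symm_add]
  have cp : (q + p).choose q = (p + q).choose p := by rw [add_comm q p, Nat.choose_symm_add]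
  rw [cm, cp, add_comm q m, add_comm q p]
  simp only [pow_add, pow_one]
  let zm := (-1 : ℝ) ^ q * oddSum N 1 * ((m + q).choose m : ℝ) * zetaSum N (m + q + 1)
  let zp := (-1 : ℝ) ^ q * oddSum N 1 * ((p + q).choose p : ℝ) * oddSum N (p + q + 1)
  split_ifs
  · linear_combination h + zm * hm + zp * hp
  · linear_combination h + zp * hp
  · linear_combination h + zm * hm
  · linear_combination h

/-! ### Limits of the regularized sums -/

lemma oddHarmonic_eq_oddSum (n r : ℕ) : oddHarmonic n r = oddSum n r := by
  induction n with
  | zero => simp [oddHarmonic, oddSum]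
  | succ n ih =>
    rw [oddHarmonic, Finset.sum_Icc_succ_top (by omega), ← oddHarmonic, ih, oddSum, oddSum,
      Finset.sum_range_succ, one_div, inv_pow]
    push_cast
    congr 3
    ring

lemma summable_inv_succ_pow {s : ℕ} (hs : 2 ≤ s) : Summable fun a : ℕ => ((a : ℝ) + 1)⁻¹ ^ s := by
  have h := (summable_nat_add_iff 1).mpr (Real.summable_nat_pow_inv.mpr (by omega : 1 < s))
  simpa [inv_pow] using h

lemma inv_add_half_le (b : ℕ) : ((b : ℝ) + 1 / 2)⁻¹ ≤ 2 * ((b : ℝ) + 1)⁻¹ := by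
  have : (0 : ℝ) ≤ b := b.cast_nonneg
  rw [← div_eq_mul_inv, inv_eq_one_div, div_le_div_iff₀ (by positivity) (by positivity)]
  linarith

lemma abs_inv_succ_pow_le {s : ℕ} (hs : 2 ≤ s) (a : ℕ) :
    |((a : ℝ) + 1)⁻¹ ^ s| ≤ 1 * ((a : ℝ) + 1)⁻¹ ^ 2 := by
  rw [abs_of_nonneg (by positivity), one_mul]
  exact pow_le_pow_of_le_one (by positivity) (inv_le_one_of_one_le₀ (by simp)) hs

lemma abs_inv_add_half_pow_le {s : ℕ} (hs : 2 ≤ s) (b : ℕ) :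
    |((b : ℝ) + 1 / 2)⁻¹ ^ s| ≤ 2 ^ s * ((b : ℝ) + 1)⁻¹ ^ 2 := by
  rw [abs_of_nonneg (by positivity)]
  calc ((b : ℝ) + 1 / 2)⁻¹ ^ s ≤ (2 * ((b : ℝ) + 1)⁻¹) ^ s := by
        gcongr
        exact inv_add_half_le b
    _ = 2 ^ s * ((b : ℝ) + 1)⁻¹ ^ s := mul_pow _ _ _
    _ ≤ _ := by
      have := abs_inv_succ_pow_le hs b
      rw [abs_of_nonneg (by positivity), one_mul] at this
      gcongr

lemma summable_of_abs_le {w : ℕ → ℝ} {K : ℝ} (hw : ∀ a : ℕ, |w a| ≤ K * ((a : ℝ) + 1)⁻¹ ^ 2) :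
    Summable w :=
  .of_norm_bounded ((summable_inv_succ_pow le_rfl).mul_left K) hw

lemma summable_inv_add_half_pow {s : ℕ} (hs : 2 ≤ s) :
    Summable fun b : ℕ => ((b : ℝ) + 1 / 2)⁻¹ ^ s :=
  summable_of_abs_le (abs_inv_add_half_pow_le hs)

lemma tTildeValue_eq (s : ℕ) : tTildeValue s = ∑' b : ℕ, ((b : ℝ) + 1 / 2)⁻¹ ^ s := by
  refine tsum_congr fun b => ?_
  rw [one_div, inv_pow]
  push_cast
  congr 2
  ring

lemma zetaValue_eq (s : ℕ) : zetaValue s = ∑' a : ℕ, ((a : ℝ) + 1)⁻¹ ^ s := by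
  refine tsum_congr fun b => ?_
  rw [one_div, inv_pow]
  push_cast
  rfl

lemma tTildeConv_eq {s : ℕ} (hs : 2 ≤ s) : tTildeConv s = tTildeValue s :=
  if_neg (by omega)

lemma zetaConv_eq {s : ℕ} (hs : 2 ≤ s) : zetaConv s = zetaValue s :=
  if_neg (by omega)

lemma tendsto_zetaSum {s : ℕ} (hs : 2 ≤ s) :
    Tendsto (fun N => zetaSum N s) atTop (𝓝 (zetaValue s)) := by
  rw [zetaValue_eq]
  exact (summable_inv_succ_pow hs).hasSum.tendsto_sum_nat

lemma tendsto_oddSum {s : ℕ} (hs : 2 ≤ s) :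
    Tendsto (fun N => oddSum N s) atTop (𝓝 (tTildeValue s)) := by
  rw [tTildeValue_eq]
  exact (summable_inv_add_half_pow hs).hasSum.tendsto_sum_nat

/-- Splitting `∑ 1 / n ^ r` over `n ≤ 2 N` into even and odd `n`. -/
lemma two_pow_mul_zetaSum (N r : ℕ) : 2 ^ r * zetaSum (2 * N) r = zetaSum N r + oddSum N r := by
  induction N with
  | zero => simp [zetaSum, oddSum]
  | succ N ih =>
    have e1 : (2 : ℝ) ^ r * (2 * (N : ℝ) + 1)⁻¹ ^ r = ((N : ℝ) + 1 / 2)⁻¹ ^ r := by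
      rw [← mul_pow]
      congr 1
      field_simp
    have e2 : (2 : ℝ) ^ r * (2 * (N : ℝ) + 1 + 1)⁻¹ ^ r = ((N : ℝ) + 1)⁻¹ ^ r := by
      rw [← mul_pow]
      congr 1
      field_simp
      ring
    have hz : zetaSum (2 * (N + 1)) r = zetaSum (2 * N) r + (2 * (N : ℝ) + 1)⁻¹ ^ r
        + (2 * (N : ℝ) + 1 + 1)⁻¹ ^ r := by
      rw [zetaSum, show 2 * (N + 1) = 2 * N + 1 + 1 by ring, Finset.sum_range_succ,
        Finset.sum_range_succ, ← zetaSum]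
      push_cast
      rfl
    rw [hz, mul_add, mul_add, ih, e1, e2, zetaSum, oddSum, zetaSum, oddSum, Finset.sum_range_succ,
      Finset.sum_range_succ]
    ring

lemma tTildeValue_eq_mul_zetaValue {s : ℕ} (hs : 2 ≤ s) :
    tTildeValue s = (2 ^ s - 1) * zetaValue s := by
  have h1 := ((tendsto_zetaSum hs).comp
    (tendsto_id.const_mul_atTop' (by norm_num : 0 < 2))).const_mul ((2 : ℝ) ^ s)
  have h2 := (tendsto_zetaSum hs).add (tendsto_oddSum hs)
  have := tendsto_nhds_unique h1 (h2.congr fun N => (two_pow_mul_zetaSum N s).symm)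
  linarith

/-- By `two_pow_mul_zetaSum` the difference is `2 (H_N - H_{2 N})` for the harmonic numbers `H`. -/
lemma tendsto_zetaSum_one_sub_oddSum_one :
    Tendsto (fun N => zetaSum N 1 - oddSum N 1) atTop (𝓝 (-2 * Real.log 2)) := by
  have hH (N : ℕ) : zetaSum N 1 = harmonic N := by
    simp [zetaSum, harmonic]
  have h1 := Real.tendsto_harmonic_sub_log
  have h2 := h1.comp (tendsto_id.const_mul_atTop' (by norm_num : 0 < 2))
  have h3 := ((h1.sub h2).const_mul 2).add_const (-2 * Real.log 2)
  rw [sub_self, mul_zero, zero_add] at h3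
  refine h3.congr' ?_
  filter_upwards [eventually_ne_atTop 0] with N hN
  have h4 := two_pow_mul_zetaSum N 1
  have h5 : Real.log ((2 * N : ℕ) : ℝ) = Real.log 2 + Real.log N := by
    rw [Nat.cast_mul, Nat.cast_ofNat, Real.log_mul two_ne_zero (Nat.cast_ne_zero.mpr hN)]
  simp only [Function.comp, id]
  rw [← hH, ← hH, h5]
  linarith

lemma tendsto_zetaReg {r : ℕ} (hr : 1 ≤ r) :
    Tendsto (fun N => zetaReg N r) atTop (𝓝 (zetaConv r)) := by
  rcases hr.eq_or_lt with rfl | hr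
  · simpa [zetaReg, zetaConv] using tendsto_zetaSum_one_sub_oddSum_one
  · rw [zetaConv_eq hr]
    simpa only [zetaReg, if_neg (by omega : r ≠ 1), sub_zero] using tendsto_zetaSum hr

lemma tendsto_oddReg {r : ℕ} (hr : 1 ≤ r) :
    Tendsto (fun N => oddReg N r) atTop (𝓝 (tTildeConv r)) := by
  rcases hr.eq_or_lt with rfl | hr
  · simp [oddReg, tTildeConv]
  · rw [tTildeConv_eq hr]
    simpa only [oddReg, if_neg (by omega : r ≠ 1), sub_zero] using tendsto_oddSum hr

/-! ### Bounds for odd harmonic numbers -/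

lemma oddSum_nonneg (n r : ℕ) : 0 ≤ oddSum n r :=
  Finset.sum_nonneg fun _ _ => by positivity

lemma oddSum_mono (r : ℕ) : Monotone fun n => oddSum n r :=
  monotone_nat_of_le_succ fun n => by
    rw [oddSum, oddSum, Finset.sum_range_succ]
    exact le_add_of_nonneg_right (by positivity)

lemma oddSum_one_le (n : ℕ) : oddSum n 1 ≤ 4 * √(n : ℝ) := by
  induction n with
  | zero => simp [oddSum]
  | succ n ih =>
    rw [oddSum, Finset.sum_range_succ, ← oddSum]
    have h0 : (0 : ℝ) ≤ n := n.cast_nonneg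
    set u := √(n : ℝ)
    set v := √((n + 1 : ℕ) : ℝ)
    have hu : u ^ 2 = n := Real.sq_sqrt h0
    have hv : v ^ 2 = n + 1 := by
      rw [Real.sq_sqrt (by positivity)]
      push_cast
      rfl
    have hu0 : 0 ≤ u := Real.sqrt_nonneg _
    have hv0 : 0 ≤ v := Real.sqrt_nonneg _
    have hvu : u ≤ v := by nlinarith
    have hv1 : 1 ≤ v := by nlinarith
    have h : ((n : ℝ) + 1 / 2)⁻¹ ≤ 4 * (v - u) := by
      rw [inv_le_iff_one_le_mul₀ (by positivity)]
      have h1 : (v - u) * (v + u) = 1 := by linear_combination hv - hu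
      have h2 : v + u ≤ 4 * ((n : ℝ) + 1 / 2) := by nlinarith
      nlinarith [mul_le_mul_of_nonneg_left h2 (sub_nonneg.mpr hvu)]
    rw [pow_one]
    linarith

lemma oddSum_le {r : ℕ} (hr : 1 ≤ r) (n : ℕ) : oddSum n r ≤ 2 ^ r * (4 * √(n : ℝ)) := by
  refine le_trans ?_ (mul_le_mul_of_nonneg_left (oddSum_one_le n) (by positivity))
  obtain ⟨r, rfl⟩ := Nat.exists_eq_add_of_le' hr
  rw [oddSum, oddSum, Finset.mul_sum]
  refine Finset.sum_le_sum fun k _ => ?_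
  have h2 : ((k : ℝ) + 1 / 2)⁻¹ ≤ 2 := by
    rw [inv_le_comm₀ (by positivity) two_pos]
    linarith [(k.cast_nonneg : (0 : ℝ) ≤ k)]
  rw [pow_succ, pow_one]
  gcongr
  calc ((k : ℝ) + 1 / 2)⁻¹ ^ r ≤ 2 ^ r := by gcongr
    _ ≤ 2 ^ (r + 1) := by gcongr <;> norm_num

lemma summable_sqrt_mul_inv_sq : Summable fun a : ℕ => ((a : ℝ) + 1)⁻¹ ^ 2 * √((a : ℝ) + 1) := by
  have h := (summable_nat_add_iff 1).mpr (Real.summable_nat_rpow.mpr (by norm_num : (-3 / 2 : ℝ) < -1))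
  refine h.congr fun a => ?_
  have ha : (0 : ℝ) < (a : ℝ) + 1 := by positivity
  rw [Real.sqrt_eq_rpow, inv_pow, ← Real.rpow_natCast, ← Real.rpow_neg ha.le, ← Real.rpow_add ha]
  push_cast
  norm_num

lemma summable_mul_oddSum {w : ℕ → ℝ} {K : ℝ} (hw : ∀ a : ℕ, |w a| ≤ K * ((a : ℝ) + 1)⁻¹ ^ 2)
    {c : ℕ → ℕ} (hc : ∀ a, c a ≤ a + 1) {r : ℕ} (hr : 1 ≤ r) :
    Summable fun a => w a * oddSum (c a) r := by
  refine .of_norm_bounded (summable_sqrt_mul_inv_sq.mul_left (K * (2 ^ r * 4))) fun a => ?_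
  rw [Real.norm_eq_abs, abs_mul, abs_of_nonneg (oddSum_nonneg _ _)]
  have h1 : oddSum (c a) r ≤ 2 ^ r * (4 * √((a : ℝ) + 1)) := by
    simpa using (oddSum_mono r (hc a)).trans (oddSum_le hr (a + 1))
  calc _ ≤ (K * ((a : ℝ) + 1)⁻¹ ^ 2) * (2 ^ r * (4 * √((a : ℝ) + 1))) :=
        mul_le_mul (hw a) h1 (oddSum_nonneg _ _) ((abs_nonneg _).trans (hw a))
    _ = _ := by ring

lemma oddSum_sub_oddSum {c N : ℕ} (h : c ≤ N) (r : ℕ) :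
    oddSum N r - oddSum (N - c) r = ∑ k ∈ range c, (((N - c : ℕ) : ℝ) + k + 1 / 2)⁻¹ ^ r := by
  obtain ⟨d, rfl⟩ := Nat.exists_eq_add_of_le' h
  rw [Nat.add_sub_cancel, oddSum, Finset.sum_range_add, ← oddSum, add_sub_cancel_left]
  push_cast
  rfl

lemma tTildeValue_nonneg (r : ℕ) : 0 ≤ tTildeValue r := by
  rw [tTildeValue_eq]
  exact tsum_nonneg fun _ => by positivity

/-- The bound is uniform in `N`, as needed for dominated convergence. -/
lemma abs_oddSum_sub_le {c N r : ℕ} (hr : 1 ≤ r) (h : c ≤ N) :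
    |oddSum (N - c) r - if r = 1 then oddSum N 1 else 0| ≤ tTildeValue r + oddSum c r := by
  rcases hr.eq_or_lt with rfl | hr
  · rw [if_pos rfl, abs_sub_comm, oddSum_sub_oddSum h,
      abs_of_nonneg (Finset.sum_nonneg fun _ _ => by positivity)]
    refine le_add_of_nonneg_of_le (tTildeValue_nonneg 1) (Finset.sum_le_sum fun k _ => ?_)
    gcongr
    exact le_add_of_nonneg_left (Nat.cast_nonneg _)
  · rw [if_neg (by omega), sub_zero, abs_of_nonneg (oddSum_nonneg _ _)]
    exact le_add_of_le_of_nonneg ((oddSum_mono r).ge_of_tendsto (tendsto_oddSum hr) _)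
      (oddSum_nonneg _ _)

/-- For `r = 1` the shifted difference tends to `0 = t̃(1)`, being a sum of `c` terms that tend
to `0`. -/
lemma tendsto_oddSum_sub {r : ℕ} (hr : 1 ≤ r) (c : ℕ) :
    Tendsto (fun N => oddSum (N - c) r - if r = 1 then oddSum N 1 else 0) atTop
      (𝓝 (tTildeConv r)) := by
  rcases hr.eq_or_lt with rfl | hr
  · have h (k : ℕ) : Tendsto (fun N : ℕ => (((N - c : ℕ) : ℝ) + k + 1 / 2)⁻¹ ^ 1) atTop (𝓝 0) := by
      simp only [pow_one, add_assoc]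
      exact tendsto_inv_atTop_zero.comp (tendsto_atTop_add_const_right _ _
        (tendsto_natCast_atTop_atTop.comp (tendsto_sub_atTop_nat c)))
    have h' := (tendsto_finsetSum (range c) fun k _ => h k).neg
    simp only [Finset.sum_const_zero, neg_zero] at h'
    rw [tTildeConv, if_pos rfl]
    refine h'.congr' ?_
    filter_upwards [eventually_ge_atTop c] with N hN
    rw [← oddSum_sub_oddSum hN, if_pos rfl]
    ring
  · simp only [if_neg (by omega : r ≠ 1), sub_zero, tTildeConv_eq hr]
    exact (tendsto_oddSum hr).comp (tendsto_sub_atTop_nat c)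

/-! ### Passage to the limit -/

/-- The common form of the limits of `truncS`, where `c a = a + 1`, and `truncT`, where `c a = a`. -/
lemma tendsto_sum_mul_oddSum {w : ℕ → ℝ} {K : ℝ} (hw : ∀ a : ℕ, |w a| ≤ K * ((a : ℝ) + 1)⁻¹ ^ 2)
    {c : ℕ → ℕ} (hc : ∀ a, c a ≤ a + 1) {r : ℕ} (hr : 1 ≤ r) :
    Tendsto (fun N => ∑ a ∈ range N, w a * (oddSum (N - c a) r + (-1) ^ r * oddSum (c a) r)
        - if r = 1 then oddSum N 1 * ∑ a ∈ range N, w a else 0) atTop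
      (𝓝 (tTildeConv r * ∑' a, w a + (-1) ^ r * ∑' a, w a * oddSum (c a) r)) := by
  have hs := summable_of_abs_le hw
  have hso := summable_mul_oddSum hw hc hr
  have hlim : tTildeConv r * ∑' a, w a + (-1) ^ r * ∑' a, w a * oddSum (c a) r
      = ∑' a, w a * (tTildeConv r + (-1) ^ r * oddSum (c a) r) := by
    rw [← tsum_mul_left, ← tsum_mul_left, ← (hs.mul_left _).tsum_add (hso.mul_left _)]
    exact tsum_congr fun _ => by ring
  rw [hlim]
  have hb : Summable fun a => |w a| * tTildeValue r + 2 * |w a * oddSum (c a) r| :=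
    (hs.abs.mul_right _).add (hso.abs.mul_left 2)
  refine (tendsto_tsum_of_dominated_convergence (f := fun N a => if a ∈ range N then
    w a * ((oddSum (N - c a) r - if r = 1 then oddSum N 1 else 0) + (-1) ^ r * oddSum (c a) r)
    else 0) hb (fun a => ?_) (.of_forall fun N a => ?_)).congr fun N => ?_
  · refine (((tendsto_oddSum_sub hr (c a)).add_const _).const_mul (w a)).congr' ?_
    filter_upwards [eventually_gt_atTop a] with N hN
    rw [if_pos (mem_range.mpr hN)]
  · by_cases ha : a ∈ range N
    · rw [if_pos ha]
      have hcN : c a ≤ N := (hc a).trans (mem_range.mp ha)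
      rw [Real.norm_eq_abs, abs_mul, abs_mul, abs_of_nonneg (oddSum_nonneg (c a) r)]
      have h1 := abs_oddSum_sub_le hr hcN
      have h2 : |(-1) ^ r * oddSum (c a) r| = oddSum (c a) r := by
        rw [abs_mul, abs_pow, abs_neg, abs_one, one_pow, one_mul, abs_of_nonneg (oddSum_nonneg _ _)]
      calc _ ≤ |w a| * ((tTildeValue r + oddSum (c a) r) + oddSum (c a) r) := by
            refine mul_le_mul_of_nonneg_left ((abs_add_le _ _).trans ?_) (abs_nonneg _)
            rw [h2]
            exact add_le_add_left h1 _
        _ = _ := by ring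
    · rw [if_neg ha, norm_zero]
      have := tTildeValue_nonneg r
      positivity
  · rw [tsum_eq_sum (s := range N) fun a ha => if_neg ha, Finset.sum_congr rfl fun a ha => if_pos ha]
    split_ifs
    · rw [Finset.mul_sum, ← Finset.sum_sub_distrib]
      exact Finset.sum_congr rfl fun _ _ => by ring
    · simp only [sub_zero]

lemma inv_succ_pow_mul_oddSum (r s a : ℕ) :
    ((a : ℝ) + 1)⁻¹ ^ s * oddSum (a + 1) r = termS r s (a + 1) := by
  rw [termS, oddHarmonic_eq_oddSum, div_eq_inv_mul, inv_pow]
  push_cast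
  rfl

lemma inv_add_half_pow_mul_oddSum (r s b : ℕ) :
    ((b : ℝ) + 1 / 2)⁻¹ ^ s * oddSum b r = termT r s (b + 1) := by
  rw [termT, oddHarmonic_eq_oddSum, inv_pow, Nat.add_sub_cancel,
    show ((b + 1 : ℕ) : ℝ) - 1 / 2 = b + 1 / 2 by push_cast; ring, inv_mul_eq_div]

lemma tendsto_truncS {r s : ℕ} (hr : 1 ≤ r) (hs : 2 ≤ s) :
    Tendsto (fun N => truncS N r s - if r = 1 then oddSum N 1 * zetaSum N s else 0) atTop
      (𝓝 (tTildeConv r * zetaConv s + (-1) ^ r * sumS r s)) := by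
  have h := tendsto_sum_mul_oddSum (abs_inv_succ_pow_le hs) (fun a => le_refl (a + 1)) hr
  rw [zetaConv_eq hs, zetaValue_eq]
  simp only [inv_succ_pow_mul_oddSum] at h
  exact h

lemma tendsto_truncT {r s : ℕ} (hr : 1 ≤ r) (hs : 2 ≤ s) :
    Tendsto (fun N => truncT N r s - if r = 1 then oddSum N 1 * oddSum N s else 0) atTop
      (𝓝 (tTildeConv r * tTildeConv s + (-1) ^ r * sumT r s)) := by
  have h := tendsto_sum_mul_oddSum (abs_inv_add_half_pow_le hs) (fun b => b.le_succ) hr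
  rw [tTildeConv_eq hs, tTildeValue_eq]
  simp only [inv_add_half_pow_mul_oddSum] at h
  exact h

/-! ### The relation between the series and its consequences -/

lemma tendsto_lam {m p q : ℕ} {Ω : ℕ → ℕ → ℕ → ℝ} {Ω' : ℕ → ℕ → ℝ}
    (h : ∀ i j, Tendsto (fun N => Ω N (p + i) (q + j)) atTop (𝓝 (Ω' (p + i) (q + j)))) :
    Tendsto (fun N => lam m (Ω N) p q) atTop (𝓝 (lam m Ω' p q)) :=
  tendsto_finsetSum _ fun ij _ => (h ij.1 ij.2).const_mul _

/-- The limit of `lam_regularized` as `N → ∞`. -/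
lemma lam_limit (m p q : ℕ) (hq : q ≠ 0) :
    (-1) ^ q * lam (q + 1) (fun a b => zetaConv a * tTildeConv b) (m + 1) (p + 1)
      + (-1) ^ m * lam (m + 1) (fun r s => (-1) ^ s *
          (tTildeConv r * zetaConv s + (-1) ^ r * sumS r s)) (p + 1) (q + 1)
      + (-1) ^ p * lam (p + 1) (fun r s => (-1) ^ s *
          (tTildeConv r * tTildeConv s + (-1) ^ r * sumT r s)) (m + 1) (q + 1) = 0 := by
  refine tendsto_nhds_unique (Tendsto.add (Tendsto.add (.const_mul _ (tendsto_lam fun i j => ?_))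
    (.const_mul _ (tendsto_lam fun i j => ?_))) (.const_mul _ (tendsto_lam fun i j => ?_)))
    (tendsto_const_nhds.congr fun N => (lam_regularized N m p q hq).symm)
  · exact (tendsto_zetaReg (by omega)).mul (tendsto_oddReg (by omega))
  · exact (tendsto_truncS (by omega) (by omega)).const_mul _
  · exact (tendsto_truncT (by omega) (by omega)).const_mul _

/-- In `λ_{m+1}(Ω_{p+1,q+1})` the sum of the two indices is constant, so the sign `(-1) ^ s` may be
traded for `(-1) ^ r`. -/
lemma lam_neg_one_pow (m p q : ℕ) (t : ℕ → ℕ → ℝ) (U : ℕ → ℕ → ℝ) :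
    lam (m + 1) (fun r s => (-1) ^ s * (t r s + (-1) ^ r * U r s)) (p + 1) (q + 1)
      = (-1) ^ (m + p + q) *
        (lam (m + 1) (fun r s => (-1) ^ r * t r s) (p + 1) (q + 1)
          + lam (m + 1) U (p + 1) (q + 1)) := by
  rw [← lam_add, ← lam_const_mul]
  refine lam_congr fun i j hij => ?_
  have hm : m = i + j := by omega
  have h (k : ℕ) : ((-1 : ℝ) ^ k) * (-1) ^ k = 1 := by rw [← mul_pow]; simp
  rw [hm]
  simp only [pow_add, pow_one]
  linear_combination ((-1) ^ q * (-1) ^ j * t (p + 1 + i) (q + 1 + j)) *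
    ((-1) ^ i * (-1) ^ i * h p + h i)

/-- The relation, with `m`, `p`, `q` shifted by one. -/
theorem lam_sumT_add_lam_sumS (m p q : ℕ) (hq : q ≠ 0) :
    (-1) ^ m * lam (p + 1) sumT (m + 1) (q + 1) + (-1) ^ p * lam (m + 1) sumS (p + 1) (q + 1)
      = (-1) ^ (m + 1) * lam (p + 1)
          (fun a b => (-1) ^ a * tTildeConv a * tTildeConv b) (m + 1) (q + 1)
        + (-1) ^ (p + 1) * lam (m + 1)
          (fun a b => (-1) ^ a * tTildeConv a * zetaConv b) (p + 1) (q + 1)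
        - lam (q + 1) (fun a b => zetaConv a * tTildeConv b) (m + 1) (p + 1) := by
  have h := lam_limit m p q hq
  rw [lam_neg_one_pow m p q (fun r s => tTildeConv r * zetaConv s),
    lam_neg_one_pow p m q (fun r s => tTildeConv r * tTildeConv s)] at h
  simp only [← mul_assoc] at h
  have h1 (k : ℕ) : ((-1 : ℝ) ^ k) = 1 ∨ ((-1 : ℝ) ^ k) = -1 := neg_one_pow_eq_or ℝ k
  simp only [pow_add, pow_one] at h ⊢
  rcases h1 m with e1 | e1 <;> rcases h1 p with e2 | e2 <;> rcases h1 q with e3 | e3 <;>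
    rw [e1, e2, e3] at h <;> rw [e1, e2] <;> linarith

lemma zetaValue_mem {s : ℕ} (hs : 2 ≤ s) : zetaValue s ∈ logZetaAlgebra :=
  Algebra.subset_adjoin (Or.inr ⟨s, hs, rfl⟩)

lemma zetaConv_mem {s : ℕ} (hs : 1 ≤ s) : zetaConv s ∈ logZetaAlgebra := by
  rcases hs.eq_or_lt with rfl | hs
  · rw [zetaConv, if_pos rfl]
    exact mul_mem (neg_mem (ofNat_mem _ 2)) (Algebra.subset_adjoin (Or.inl rfl))
  · rw [zetaConv_eq hs]
    exact zetaValue_mem hs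

lemma tTildeConv_mem {s : ℕ} (hs : 1 ≤ s) : tTildeConv s ∈ logZetaAlgebra := by
  rcases hs.eq_or_lt with rfl | hs
  · rw [tTildeConv, if_pos rfl]
    exact zero_mem _
  · rw [tTildeConv_eq hs, tTildeValue_eq_mul_zetaValue hs]
    exact mul_mem (sub_mem (pow_mem (ofNat_mem _ 2) _) (one_mem _)) (zetaValue_mem hs)

lemma neg_one_pow_mem (k : ℕ) : (-1 : ℝ) ^ k ∈ logZetaAlgebra :=
  pow_mem (neg_mem (one_mem _)) k

lemma lam_mem {Ω : ℕ → ℕ → ℝ} (h : ∀ a b, 1 ≤ a → 1 ≤ b → Ω a b ∈ logZetaAlgebra) {p q : ℕ} (m : ℕ)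
    (hp : 1 ≤ p) (hq : 1 ≤ q) : lam m Ω p q ∈ logZetaAlgebra :=
  sum_mem fun _ _ => mul_mem (mul_mem (natCast_mem _ _) (natCast_mem _ _))
    (h _ _ (by omega) (by omega))

lemma summable_termT {a b : ℕ} (ha : 1 ≤ a) (hb : 2 ≤ b) :
    Summable fun n : ℕ => termT a b (n + 1) :=
  (summable_mul_oddSum (abs_inv_add_half_pow_le hb) Nat.le_succ ha).congr fun n => by
    rw [inv_add_half_pow_mul_oddSum]

lemma summable_termS {a b : ℕ} (ha : 1 ≤ a) (hb : 2 ≤ b) :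
    Summable fun n : ℕ => termS a b (n + 1) :=
  (summable_mul_oddSum (abs_inv_succ_pow_le hb) (fun n => le_refl (n + 1)) ha).congr fun n => by
    rw [inv_succ_pow_mul_oddSum]

end EulerSums

theorem theorem3p1 :
    -- convergence of all the series involved
    (∀ a b : ℕ, 1 ≤ a → 2 ≤ b →
      Summable (fun n : ℕ => EulerSums.termT a b (n + 1)) ∧
      Summable (fun n : ℕ => EulerSums.termS a b (n + 1))) ∧
    ∀ m p q : ℕ, 1 ≤ m → 1 ≤ p → 2 ≤ q →
      ((-1 : ℝ) ^ (m - 1) * EulerSums.lam p EulerSums.sumT m q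
          + (-1 : ℝ) ^ (p - 1) * EulerSums.lam m EulerSums.sumS p q
        ∈ EulerSums.logZetaAlgebra) ∧
      (-1 : ℝ) ^ (m - 1) * EulerSums.lam p EulerSums.sumT m q
          + (-1 : ℝ) ^ (p - 1) * EulerSums.lam m EulerSums.sumS p q
        = (-1 : ℝ) ^ m *
            EulerSums.lam p
              (fun a b => (-1 : ℝ) ^ a * EulerSums.tTildeConv a * EulerSums.tTildeConv b) m q
          + (-1 : ℝ) ^ p *
            EulerSums.lam m
              (fun a b => (-1 : ℝ) ^ a * EulerSums.tTildeConv a * EulerSums.zetaConv b) p q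
          - EulerSums.lam q
              (fun a b => EulerSums.zetaConv a * EulerSums.tTildeConv b) m p := by
  open EulerSums in
  refine ⟨fun a b ha hb => ⟨summable_termT ha hb, summable_termS ha hb⟩, fun m p q hm hp hq => ?_⟩
  have h := lam_sumT_add_lam_sumS (m - 1) (p - 1) (q - 1) (by omega)
  rw [Nat.sub_add_cancel hm, Nat.sub_add_cancel hp, Nat.sub_add_cancel (by omega : 1 ≤ q)] at h
  refine ⟨?_, h⟩
  rw [h]
  exact sub_mem (add_mem
    (mul_mem (neg_one_pow_mem m) (lam_mem (fun a b ha hb => mul_mem (mul_mem (neg_one_pow_mem a)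
      (tTildeConv_mem ha)) (tTildeConv_mem hb)) p hm (by omega)))
    (mul_mem (neg_one_pow_mem p) (lam_mem (fun a b ha hb => mul_mem (mul_mem (neg_one_pow_mem a)
      (tTildeConv_mem ha)) (zetaConv_mem hb)) m hp (by omega))))
    (lam_mem (fun a b ha hb => mul_mem (zetaConv_mem ha) (tTildeConv_mem hb)) q hm hp)
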